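/- Let $\Pi=\{w\in\mathbb C:\operatorname{Im}w>0\}$ and let $\mathcal P_2$ be the set of holomorphic functions $\Pi^2\to\Pi$. For $N\ge 1$, $\mathcal L^N$ is the set of $h\in\mathcal P_2$ such that $\lim_{s\to\infty}h(is,is)=0$ and such that there are real numbers $(\rho_m)_{|m|\le 2N-1}$, indexed by $m=(m_1,m_2)\in\mathbb Z_{\ge0}^2$ with $|m|=m_1+m_2$ and $z^m=z_1^{m_1}z_2^{m_2}$, with $$h(z)=\sum_{|m|\le 2N-1}\frac{\rho_m}{z^m}+o\!\left(\frac1{\|z\|^{2N-1}}\right)\quad\text{nontangentially},$$ that is, for every $c\in\mathbb R$, as $\|z\|\to\infty$ within $\{z\in\Pi^2:\|z\|\le c\min(\operatorname{Im}z_1,\operatorname{Im}z_2)\}$. The class $\mathcal L^{N-}$ is defined in the same way, with $h(z)=\sum_{|m|\le 2N-2}\rho_m/z^m+O(1/\|z\|^{2N-1})$ nontangentially. For operators $A,Y$ on a Hilbert space and a vector $\alpha$, put $z_Y=z_1Y+z_2(1-Y)$ and, for $b\in(0,\infty)^2$ and $k\ge1$, $$R_k(b)=(b_Y^{-1}A)^{k-1}b_Y^{-1}\alpha,\qquad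 r_k(b)=\langle R_{\lceil k/2\rceil}(b),\,A R_{\lfloor k/2\rfloor}(b)\rangle,$$ with the convention $AR_0=\alpha$. The functions $r_k$ are the scalar moments; "$r_k$ is a polynomial" means that on $(0,\infty)^2$ it is a polynomial in $1/b_1$ and $1/b_2$. **Theorem.** (1) Let $n\ge2$ and $0<t<1$. On $\ell^2(\mathbb Z/2(n-1))$, with standard basis $(e_i)$ and left regular representation $\pi(j)e_i=e_{j+i}$, let $A=\pi(1)+\pi(-1)$, let $Y$ be the diagonal operator with $Ye_{n-1}=te_{n-1}$ and $Ye_i=e_i$ for $i\ne n-1$, and let $\alpha=e_0$. Then $A$ is self-adjoint, $0\le Y\le 1$, $A-z_Y$ is invertible for every $z\in\Pi^2$, $b_Y$ is invertible for every $b\in(0,\infty)^2$, and $f(z)=\langle(A-z_Y)^{-1}e_0,e_0\rangle$ belongs to $\mathcal P_2$. The scalar moment $r_k$ is a polynomial for $1\le k<2n-1$, but $r_{2n-1}$ is not a polynomial. Moreover $f\in\mathcal L^{n-}$ and $f\notin\mathcal L^n$. (2) The two-variable Löwner hierarchy does not collapse: for every $N\ge1$, $\mathcal L^N\subsetneq\mathcal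 L^{N-}$. -/

import Mathlib

open Filter Topology Asymptotics

noncomputable section

namespace Loewner

/-! ### The Pick class and the Loewner classes at infinity in two variables -/

/-- The domain `Π²`, where `Π` is the open upper half plane. -/
def biUpper : Set (ℂ × ℂ) := {z | 0 < z.1.im ∧ 0 < z.2.im}

/-- The two-variable Pick class: holomorphic functions from `Π²` to `Π`.  (Functions are total on
`ℂ × ℂ`; every condition in this file only looks at their values on `Π²`.) -/
def PickClass : Set (ℂ × ℂ → ℂ) :=
  {h | DifferentiableOn ℂ h biUpper ∧ ∀ z ∈ biUpper, 0 < (h z).im}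

/-- The points of `Π²` with `‖z‖ ≤ c * min (Im z₁) (Im z₂)`. -/
def nontangentialRegion (c : ℝ) : Set (ℂ × ℂ) :=
  {z | z ∈ biUpper ∧ ‖z‖ ≤ c * min z.1.im z.2.im}

/-- The filter of all large enough `z` in the nontangential region of aperture `c`.  A formula
holds nontangentially at infinity if it holds along this filter for every real `c`.  (The norm is
the maximum norm of `ℂ × ℂ`; any other norm on `ℂ²` only changes `c` and the constants.) -/
def nontangential (c : ℝ) : Filter (ℂ × ℂ) :=
  Bornology.cobounded (ℂ × ℂ) ⊓ 𝓟 (nontangentialRegion c)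

/-- The sum of `ρ_n / z^n` over the multi-indices `n = (n₁, n₂)` with `|n| = n₁ + n₂ ≤ M`. -/
def expansion (ρ : ℕ × ℕ → ℝ) (M : ℕ) (z : ℂ × ℂ) : ℂ :=
  ∑ k ∈ Finset.range (M + 1), ∑ n ∈ Finset.HasAntidiagonal.antidiagonal k,
    (ρ n : ℂ) / (z.1 ^ n.1 * z.2 ^ n.2)

/-- The Loewner class at infinity `𝓛^N`, for `N ≥ 1`. -/
def LoewnerClass (N : ℕ) : Set (ℂ × ℂ → ℂ) :=
  {h | h ∈ PickClass ∧
    Tendsto (fun s : ℝ => h ((s : ℂ) * Complex.I, (s : ℂ) * Complex.I)) atTop (𝓝 0) ∧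
    ∃ ρ : ℕ × ℕ → ℝ, ∀ c : ℝ,
      (fun z => h z - expansion ρ (2 * N - 1) z) =o[nontangential c]
        (fun z => 1 / ‖z‖ ^ (2 * N - 1))}

/-- The intermediate Loewner class at infinity `𝓛^{N-}`, for `N ≥ 1`. -/
def IntermediateLoewnerClass (N : ℕ) : Set (ℂ × ℂ → ℂ) :=
  {h | h ∈ PickClass ∧
    Tendsto (fun s : ℝ => h ((s : ℂ) * Complex.I, (s : ℂ) * Complex.I)) atTop (𝓝 0) ∧
    ∃ ρ : ℕ × ℕ → ℝ, ∀ c : ℝ,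
      (fun z => h z - expansion ρ (2 * N - 2) z) =O[nontangential c]
        (fun z => 1 / ‖z‖ ^ (2 * N - 1))}

/-! ### Representations and moments -/

section Moments

variable {H : Type*} [NormedAddCommGroup H] [InnerProductSpace ℂ H]

/-- The operator `z_Y = z₁ Y + z₂ (1 - Y)`. -/
def weight (Y : H →L[ℂ] H) (z : ℂ × ℂ) : H →L[ℂ] H := z.1 • Y + z.2 • (1 - Y)

/-- The function `z ↦ ⟨(A - z_Y)⁻¹ α, α⟩` (Mathlib's inner product is linear in the second
variable, hence the order of the arguments). -/
def represented (A Y : H →L[ℂ] H) (α : H) (z : ℂ × ℂ) : ℂ :=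
  inner ℂ α (Ring.inverse (A - weight Y z) α)

/-- The vector moment `R_k(z) = (z_Y⁻¹ A)^(k-1) z_Y⁻¹ α`, for `k ≥ 1`. -/
def vectorMoment (A Y : H →L[ℂ] H) (α : H) (k : ℕ) (z : ℂ × ℂ) : H :=
  ((Ring.inverse (weight Y z) * A) ^ (k - 1)) (Ring.inverse (weight Y z) α)

/-- The vector `A R_k(z)`, in the form `(A z_Y⁻¹)^k α` that makes sense for `k = 0` too
(`A R_0 = α`); see `apply_vectorMoment`. -/
def imageMoment (A Y : H →L[ℂ] H) (α : H) (k : ℕ) (z : ℂ × ℂ) : H :=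
  ((A * Ring.inverse (weight Y z)) ^ k) α

theorem apply_vectorMoment (A Y : H →L[ℂ] H) (α : H) (k : ℕ) (hk : 1 ≤ k) (z : ℂ × ℂ) :
    A (vectorMoment A Y α k z) = imageMoment A Y α k z := by
  obtain ⟨j, rfl⟩ : ∃ j, k = j + 1 := ⟨k - 1, by omega⟩
  have h : ∀ B : H →L[ℂ] H, A * ((B * A) ^ j * B) = (A * B) ^ (j + 1) := by
    intro B
    induction j with
    | zero => simp
    | succ i ih => rw [pow_succ' (A * B), ← ih (by omega), pow_succ' (B * A)]; simp only [mul_assoc]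
  have := congrArg (fun T : H →L[ℂ] H => T α) (h (Ring.inverse (weight Y z)))
  simpa [vectorMoment, imageMoment] using this

/-- The scalar moment `r_k(b) = ⟨R_⌈k/2⌉(b), A R_⌊k/2⌋(b)⟩`, for `k ≥ 1` and
`b = (b₁, b₂)` with `b₁, b₂ > 0`. -/
def scalarMoment (A Y : H →L[ℂ] H) (α : H) (k : ℕ) (b : ℝ × ℝ) : ℂ :=
  inner ℂ (imageMoment A Y α (k / 2) ((b.1 : ℂ), (b.2 : ℂ)))
    (vectorMoment A Y α ((k + 1) / 2) ((b.1 : ℂ), (b.2 : ℂ)))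

end Moments

/-- A function on `(ℝ⁺)²` is a polynomial in `1 / b₁` and `1 / b₂`. -/
def IsPolynomialInInverses (r : ℝ × ℝ → ℂ) : Prop :=
  ∃ p : MvPolynomial (Fin 2) ℂ, ∀ b : ℝ × ℝ, 0 < b.1 → 0 < b.2 →
    r b = MvPolynomial.eval ![1 / (b.1 : ℂ), 1 / (b.2 : ℂ)] p

/-! ### The example on `ℓ²(ℤ / 2(n-1))` -/

section Example

variable {m : ℕ} [NeZero m]

/-- The left regular representation of `ℤ / m` on `ℓ²(ℤ / m)`; see `leftRegular_single`. -/
def leftRegular (j : ZMod m) :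
    EuclideanSpace ℂ (ZMod m) →L[ℂ] EuclideanSpace ℂ (ZMod m) :=
  ((LinearIsometryEquiv.piLpCongrLeft 2 ℂ ℂ (Equiv.addLeft j)).toContinuousLinearEquiv :
    EuclideanSpace ℂ (ZMod m) →L[ℂ] EuclideanSpace ℂ (ZMod m))

theorem leftRegular_single (j i : ZMod m) :
    leftRegular j (EuclideanSpace.single i (1 : ℂ)) = EuclideanSpace.single (j + i) (1 : ℂ) := by
  ext a
  simp [leftRegular]

/-- `A = π(1) + π(-1)`. -/
def exampleA (m : ℕ) [NeZero m] :
    EuclideanSpace ℂ (ZMod m) →L[ℂ] EuclideanSpace ℂ (ZMod m) :=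
  leftRegular 1 + leftRegular (-1)

/-- The diagonal operator with `Y e_j = t e_j` and `Y e_i = e_i` for `i ≠ j`; see
`exampleY_single`. -/
def exampleY {m : ℕ} [NeZero m] (j : ZMod m) (t : ℝ) :
    EuclideanSpace ℂ (ZMod m) →L[ℂ] EuclideanSpace ℂ (ZMod m) :=
  Matrix.toEuclideanCLM (𝕜 := ℂ) (n := ZMod m)
    (Matrix.diagonal fun i => if i = j then (t : ℂ) else 1)

theorem exampleY_single (j i : ZMod m) (t : ℝ) :
    exampleY j t (EuclideanSpace.single i (1 : ℂ)) =
      (if i = j then (t : ℂ) else 1) • EuclideanSpace.single i (1 : ℂ) := by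
  ext a
  by_cases h : a = i
  · subst h
    by_cases h' : a = j <;> simp [exampleY, Matrix.mulVec_diagonal, h']
  · by_cases h' : i = j
    · subst h'
      simp [exampleY, Matrix.mulVec_diagonal, h]
    · simp [exampleY, Matrix.mulVec_diagonal, h, h']

end Example

end Loewner

end

open Filter Topology Asymptotics

noncomputable section

namespace Loewner

/-! ### Coercivity and resolvent bounds. -/

section Resolvent

variable {H : Type*} [NormedAddCommGroup H] [InnerProductSpace ℂ H]

/-! Put `M = n - 1`. On the cycle of length `2M`, `Y` differs from the identity only at the point
antipodal to `0`, which a walk from `0` cannot reach in fewer than `M` steps. So `Y` fixes `A^q e_0`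
for `q < M` (`exampleY_fixed`), `z_Y⁻¹` acts on these vectors as `1 / z₁`, and the moments of order
at most `2M` are multiples of powers of `1 / z₁`. In order `2M + 1` the form of `z_Y⁻¹` is evaluated
at `A^M e_0`, whose antipodal coordinate is nonzero; it contributes a nonzero multiple of `1 /
(z₁^(2M) (t z₁ + (1 - t) z₂))` (`seriesTerm_example_top`). This has a pole off the axes, so it is
not a polynomial in `1 / b₁`, `1 / b₂` (`not_isPolynomial_inv_mix`).

Up to sign these moments are the terms of the Neumann series of `f`. Since `A` is self-adjoint, `(A
- z_Y)⁻¹` and `z_Y⁻¹` are both bounded by `1 / min (Im z₁) (Im z₂)`, so truncating the series leaves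
a nontangential error of the next order (`represented_add_sum_isBigO`). Stopping after order `2M`
gives `f ∈ 𝓛^{n-}`. One order further, uniqueness of homogeneous expansions along rays would force
the nonpolynomial part to be polynomial if `f ∈ 𝓛^n` (`isPolynomial_of_mem_LoewnerClass`).

These examples separate the classes for `N ≥ 2`; for `N = 1` the function `-2 / (z₁ + z₂)` does. -/

theorem isUnit_of_coercive [FiniteDimensional ℂ H] (T : H →L[ℂ] H) {μ : ℝ} (hμ : 0 < μ)
    (h : ∀ u, μ * ‖u‖ ^ 2 ≤ ‖inner ℂ u (T u)‖) :
    IsUnit T ∧ ‖Ring.inverse T‖ ≤ μ⁻¹ := by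
  have : CompleteSpace H := FiniteDimensional.complete ℂ H
  have hT : ∀ u, μ * ‖u‖ ≤ ‖T u‖ := by
    intro u
    rcases eq_or_ne u 0 with rfl | hu
    · simp
    · have hu' : 0 < ‖u‖ := norm_pos_iff.2 hu
      have := (h u).trans (norm_inner_le_norm u (T u))
      nlinarith
  have hinj : Function.Injective T := by
    refine (injective_iff_map_eq_zero T).2 fun u hu => ?_
    have := hT u
    rw [hu, norm_zero] at this
    exact norm_le_zero_iff.1 (by nlinarith [norm_nonneg u])
  have hunit : IsUnit T := ContinuousLinearMap.isUnit_iff_bijective.2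
    ⟨hinj, (LinearMap.injective_iff_surjective (f := (T : H →ₗ[ℂ] H))).1 hinj⟩
  refine ⟨hunit, ContinuousLinearMap.opNorm_le_bound _ (by positivity) fun v => ?_⟩
  have h1 : T (Ring.inverse T v) = v :=
    congrArg (fun S : H →L[ℂ] H => S v) (Ring.mul_inverse_cancel T hunit)
  have h2 := hT (Ring.inverse T v)
  rw [h1] at h2
  rwa [inv_mul_eq_div, le_div_iff₀' hμ]

theorem inner_weight (Y : H →L[ℂ] H) (z : ℂ × ℂ) (u : H) :
    inner ℂ u (weight Y z u) = z.1 * inner ℂ u (Y u) + z.2 * inner ℂ u ((1 - Y) u) := by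
  simp [weight]

theorem IsPositive.inner_eq_ofReal {Y : H →L[ℂ] H} (hY : Y.IsPositive) (u : H) :
    ∃ y : ℝ, 0 ≤ y ∧ inner ℂ u (Y u) = (y : ℂ) := by
  obtain ⟨h1, h2⟩ := Complex.nonneg_iff.1 (hY.inner_nonneg_right u)
  exact ⟨_, h1, Complex.ext rfl h2.symm⟩

/-- The quadratic form of `z_Y` is a combination of `z₁` and `z₂` of total mass `‖u‖²`. -/
theorem exists_inner_weight {Y : H →L[ℂ] H} (hY : Y.IsPositive) (hY' : (1 - Y).IsPositive)
    (u : H) : ∃ x y : ℝ, 0 ≤ x ∧ 0 ≤ y ∧ x + y = ‖u‖ ^ 2 ∧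
      ∀ z : ℂ × ℂ, inner ℂ u (weight Y z u) = z.1 * x + z.2 * y := by
  obtain ⟨x, hx, hx'⟩ := IsPositive.inner_eq_ofReal hY u
  obtain ⟨y, hy, hy'⟩ := IsPositive.inner_eq_ofReal hY' u
  refine ⟨x, y, hx, hy, ?_, fun z => by rw [inner_weight, hx', hy']⟩
  have : (x : ℂ) + y = ((‖u‖ ^ 2 : ℝ) : ℂ) := by
    rw [← hx', ← hy', ← inner_add_right]
    simp [inner_self_eq_norm_sq_to_K]
  exact_mod_cast this

theorem min_im_mul_le {Y : H →L[ℂ] H} (hY : Y.IsPositive) (hY' : (1 - Y).IsPositive)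
    (z : ℂ × ℂ) (u : H) :
    min z.1.im z.2.im * ‖u‖ ^ 2 ≤ (inner ℂ u (weight Y z u)).im := by
  obtain ⟨x, y, hx, hy, hxy, h⟩ := exists_inner_weight hY hY' u
  rw [h, ← hxy]
  simp only [Complex.add_im, Complex.im_mul_ofReal]
  nlinarith [mul_le_mul_of_nonneg_right (min_le_left z.1.im z.2.im) hx,
    mul_le_mul_of_nonneg_right (min_le_right z.1.im z.2.im) hy]

theorem weight_coercive {Y : H →L[ℂ] H} (hY : Y.IsPositive) (hY' : (1 - Y).IsPositive)
    (z : ℂ × ℂ) (u : H) :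
    min z.1.im z.2.im * ‖u‖ ^ 2 ≤ ‖inner ℂ u (weight Y z u)‖ :=
  (min_im_mul_le hY hY' z u).trans ((le_abs_self _).trans (Complex.abs_im_le_norm _))

theorem im_inner_self_adjoint_sub {A : H →L[ℂ] H} (hA : (A : H →ₗ[ℂ] H).IsSymmetric)
    (W : H →L[ℂ] H) (u : H) : (inner ℂ u ((A - W) u)).im = -(inner ℂ u (W u)).im := by
  have : (inner ℂ u (A u) : ℂ).im = 0 := hA.im_inner_self_apply u
  simp [this]

/-- The quadratic form of `A` is real, so it does not affect the imaginary part that bounds the form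
of `z_Y` from below. -/
theorem sub_weight_coercive {A Y : H →L[ℂ] H} (hA : (A : H →ₗ[ℂ] H).IsSymmetric)
    (hY : Y.IsPositive) (hY' : (1 - Y).IsPositive) (z : ℂ × ℂ) (u : H) :
    min z.1.im z.2.im * ‖u‖ ^ 2 ≤ ‖inner ℂ u ((A - weight Y z) u)‖ := by
  refine (min_im_mul_le hY hY' z u).trans ?_
  rw [← neg_neg (inner ℂ u (weight Y z u)).im, ← im_inner_self_adjoint_sub hA]
  exact (neg_le_abs _).trans (Complex.abs_im_le_norm _)

theorem isUnit_weight_ofReal [FiniteDimensional ℂ H] {Y : H →L[ℂ] H} (hY : Y.IsPositive)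
    (hY' : (1 - Y).IsPositive) {b : ℝ × ℝ} (h1 : 0 < b.1) (h2 : 0 < b.2) :
    IsUnit (weight Y ((b.1 : ℂ), (b.2 : ℂ))) := by
  refine (isUnit_of_coercive _ (lt_min h1 h2) fun u => ?_).1
  -- For positive `b` real parts play the role that imaginary parts play on `Π²`.
  obtain ⟨x, y, hx, hy, hxy, h⟩ := exists_inner_weight hY hY' u
  rw [h, ← hxy]
  refine le_trans ?_ (Complex.re_le_norm _)
  simp only [Complex.add_re, Complex.re_mul_ofReal, Complex.ofReal_re]
  nlinarith [mul_le_mul_of_nonneg_right (min_le_left b.1 b.2) hx,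
    mul_le_mul_of_nonneg_right (min_le_right b.1 b.2) hy]

theorem differentiable_weight (Y : H →L[ℂ] H) : Differentiable ℂ (weight Y) := by
  unfold weight
  fun_prop

theorem represented_mem_PickClass [FiniteDimensional ℂ H] {A Y : H →L[ℂ] H}
    (hA : (A : H →ₗ[ℂ] H).IsSymmetric) (hY : Y.IsPositive) (hY' : (1 - Y).IsPositive) {α : H}
    (hα : α ≠ 0) : represented A Y α ∈ PickClass := by
  have : CompleteSpace H := FiniteDimensional.complete ℂ H
  have hunit : ∀ z ∈ biUpper, IsUnit (A - weight Y z) := fun z hz =>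
    (isUnit_of_coercive _ (lt_min hz.1 hz.2) (sub_weight_coercive hA hY hY' z)).1
  refine ⟨fun z hz => DifferentiableAt.differentiableWithinAt ?_, fun z hz => ?_⟩
  · have h1 : DifferentiableAt ℂ (fun z => Ring.inverse (A - weight Y z)) z := by
      refine DifferentiableAt.comp (g := Ring.inverse) z ?_
        ((differentiableAt_const A).sub (differentiable_weight Y z))
      exact differentiableAt_inverse (hunit z hz)
    exact ((innerSL ℂ α).differentiableAt).comp z (h1.clm_apply (differentiableAt_const α))
  -- With `u = (A - z_Y)⁻¹ α`, the value is `⟨α, u⟩` with `α = (A - z_Y) u`, so its imaginary part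
  -- is that of the form of `z_Y` at `u ≠ 0`.
  · set u := Ring.inverse (A - weight Y z) α with hu
    have h1 : (A - weight Y z) u = α :=
      congrArg (fun S : H →L[ℂ] H => S α) (Ring.mul_inverse_cancel _ (hunit z hz))
    have hu0 : u ≠ 0 := by
      rintro h0
      rw [h0, map_zero] at h1
      exact hα h1.symm
    have h2 := im_inner_self_adjoint_sub hA (weight Y z) u
    rw [h1] at h2
    have h3 : (represented A Y α z).im = -(inner ℂ u α : ℂ).im := by
      rw [represented, ← hu, ← inner_conj_symm, Complex.conj_im]
    rw [h3, h2, neg_neg]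
    exact lt_of_lt_of_le (mul_pos (lt_min hz.1 hz.2) (by positivity)) (min_im_mul_le hY hY' z u)

/-! ### The Neumann series with remainder. -/

theorem inverse_sub_eq_sum {R : Type*} [Ring R] {a w : R} (hw : IsUnit w) (h : IsUnit (a - w))
    (K : ℕ) : Ring.inverse (a - w) =
      -∑ k ∈ Finset.range K, Ring.inverse w * (a * Ring.inverse w) ^ k +
        Ring.inverse (a - w) * (a * Ring.inverse w) ^ K := by
  have h1 : Ring.inverse (a - w) =
      -Ring.inverse w + Ring.inverse (a - w) * (a * Ring.inverse w) := by
    have h2 := Ring.inverse_mul_cancel _ h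
    have h3 := Ring.mul_inverse_cancel _ hw
    calc Ring.inverse (a - w) = Ring.inverse (a - w) * (w * Ring.inverse w) := by rw [h3, mul_one]
      _ = -(Ring.inverse (a - w) * (a - w)) * Ring.inverse w
          + Ring.inverse (a - w) * (a * Ring.inverse w) := by noncomm_ring
      _ = _ := by rw [h2, neg_one_mul]
  induction K with
  | zero => simp
  | succ K ih =>
    rw [Finset.sum_range_succ, pow_succ' _ K]
    calc Ring.inverse (a - w) = _ := ih
      _ = -∑ k ∈ Finset.range K, Ring.inverse w * (a * Ring.inverse w) ^ k +
        (-Ring.inverse w + Ring.inverse (a - w) * (a * Ring.inverse w)) *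
          (a * Ring.inverse w) ^ K := by rw [← h1]
      _ = _ := by noncomm_ring

/-- The coefficient `⟨z_Y⁻¹ (A z_Y⁻¹)^k α, α⟩` of the Neumann series of `-⟨(A - z_Y)⁻¹ α, α⟩`. -/
def seriesTerm (A Y : H →L[ℂ] H) (α : H) (k : ℕ) (z : ℂ × ℂ) : ℂ :=
  inner ℂ α ((Ring.inverse (weight Y z) * (A * Ring.inverse (weight Y z)) ^ k) α)

/-- The remainder `(A - z_Y)⁻¹ (A z_Y⁻¹)^K` contains `K + 1` inverses, each of norm at most `|c| /
‖z‖` in the region of aperture `c`. -/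
theorem represented_add_sum_isBigO [FiniteDimensional ℂ H] {A Y : H →L[ℂ] H}
    (hA : (A : H →ₗ[ℂ] H).IsSymmetric) (hY : Y.IsPositive) (hY' : (1 - Y).IsPositive) (α : H)
    (K : ℕ) (c : ℝ) :
    (fun z => represented A Y α z + ∑ k ∈ Finset.range K, seriesTerm A Y α k z)
      =O[nontangential c] (fun z => 1 / ‖z‖ ^ (K + 1)) := by
  refine IsBigO.of_bound (‖α‖ * (|c| * (‖A‖ * |c|) ^ K * ‖α‖)) ?_
  refine mem_inf_of_right ?_
  rintro z ⟨hz, hzc⟩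
  have hμ := lt_min hz.1 hz.2
  obtain ⟨hw, hw'⟩ := isUnit_of_coercive _ hμ (weight_coercive hY hY' z)
  obtain ⟨hG, hG'⟩ := isUnit_of_coercive _ hμ (sub_weight_coercive hA hY hY' z)
  have hz0 : 0 < ‖z‖ := by
    refine norm_pos_iff.2 ?_
    rintro rfl
    exact absurd hz.1 (by simp)
  have hinv : (min z.1.im z.2.im)⁻¹ ≤ |c| / ‖z‖ := by
    rw [inv_eq_one_div, div_le_div_iff₀ hμ hz0, one_mul]
    exact hzc.trans (mul_le_mul_of_nonneg_right (le_abs_self c) hμ.le)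
  have hw'' := hw'.trans hinv
  have hG'' := hG'.trans hinv
  set Wi := Ring.inverse (weight Y z)
  set G := Ring.inverse (A - weight Y z)
  have key : represented A Y α z + ∑ k ∈ Finset.range K, seriesTerm A Y α k z =
      inner ℂ α ((G * (A * Wi) ^ K) α) := by
    have h := inverse_sub_eq_sum hw hG K
    simp only [represented, seriesTerm]
    rw [h, ← inner_sum, ← inner_add_right]
    congr 1
    simp only [add_apply, neg_apply,
      sum_apply]
    rw [neg_add_eq_sub, sub_add_cancel]
  have hnorm : ‖G * (A * Wi) ^ K‖ ≤ |c| / ‖z‖ * (‖A‖ * (|c| / ‖z‖)) ^ K := by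
    rcases Nat.eq_zero_or_pos K with rfl | hK
    · simpa using hG''
    · calc ‖G * (A * Wi) ^ K‖ ≤ ‖G‖ * ‖(A * Wi) ^ K‖ := norm_mul_le _ _
        _ ≤ ‖G‖ * (‖A‖ * ‖Wi‖) ^ K := by
          gcongr
          exact (norm_pow_le' _ hK).trans (pow_le_pow_left₀ (norm_nonneg _) (norm_mul_le _ _) _)
        _ ≤ _ := by gcongr
  show ‖represented A Y α z + ∑ k ∈ Finset.range K, seriesTerm A Y α k z‖ ≤ _
  rw [key]
  calc ‖inner ℂ α ((G * (A * Wi) ^ K) α)‖ ≤ ‖α‖ * ‖(G * (A * Wi) ^ K) α‖ :=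
        norm_inner_le_norm _ _
    _ ≤ ‖α‖ * ((|c| / ‖z‖ * (‖A‖ * (|c| / ‖z‖)) ^ K) * ‖α‖) := by
        gcongr
        exact ContinuousLinearMap.le_of_opNorm_le _ hnorm α
    _ = _ := by
        rw [Real.norm_of_nonneg (by positivity)]
        rw [show ‖A‖ * (|c| / ‖z‖) = (‖A‖ * |c|) / ‖z‖ by ring, div_pow, pow_succ']
        field_simp

theorem tendsto_represented_zero [FiniteDimensional ℂ H] {A Y : H →L[ℂ] H}
    (hA : (A : H →ₗ[ℂ] H).IsSymmetric) (hY : Y.IsPositive) (hY' : (1 - Y).IsPositive) (α : H) :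
    Tendsto (fun s : ℝ => represented A Y α ((s : ℂ) * Complex.I, (s : ℂ) * Complex.I))
      atTop (𝓝 0) := by
  have hlim : Tendsto (fun s : ℝ => ‖α‖ * (s⁻¹ * ‖α‖)) atTop (𝓝 0) := by
    simpa using (tendsto_inv_atTop_zero.mul_const ‖α‖).const_mul ‖α‖
  refine squeeze_zero_norm' ?_ hlim
  filter_upwards [eventually_gt_atTop 0] with s hs
  have h := (isUnit_of_coercive (μ := s)
    (A - weight Y ((s : ℂ) * Complex.I, (s : ℂ) * Complex.I)) hs fun u => by
      have h := sub_weight_coercive hA hY hY' ((s : ℂ) * Complex.I, (s : ℂ) * Complex.I) u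
      have hI : ((s : ℂ) * Complex.I).im = s := by simp
      rwa [hI, min_self] at h).2
  exact (norm_inner_le_norm _ _).trans (mul_le_mul_of_nonneg_left
    (ContinuousLinearMap.le_of_opNorm_le _ h α) (norm_nonneg _))

/-! ### Series terms while `Y` fixes the Krylov vectors. -/

theorem weight_apply_of_fixed {Y : H →L[ℂ] H} {x : H} (hx : Y x = x) (z : ℂ × ℂ) :
    weight Y z x = z.1 • x := by
  simp [weight, hx]

theorem inverse_weight_apply_of_fixed {Y : H →L[ℂ] H} {z : ℂ × ℂ} (hw : IsUnit (weight Y z))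
    (hz : z.1 ≠ 0) {x : H} (hx : Y x = x) : Ring.inverse (weight Y z) x = z.1⁻¹ • x := by
  have h : Ring.inverse (weight Y z) (weight Y z x) = x :=
    congrArg (fun S : H →L[ℂ] H => S x) (Ring.inverse_mul_cancel _ hw)
  rw [weight_apply_of_fixed hx, map_smul] at h
  rw [eq_inv_smul_iff₀ hz, h]

theorem inner_inverse_weight_of_fixed {Y : H →L[ℂ] H} (hY : (Y : H →ₗ[ℂ] H).IsSymmetric)
    {z : ℂ × ℂ} (hw : IsUnit (weight Y z)) (hz : z.1 ≠ 0) {x : H} (hx : Y x = x) (v : H) :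
    inner ℂ x (Ring.inverse (weight Y z) v) = z.1⁻¹ * inner ℂ x v := by
  have h : weight Y z (Ring.inverse (weight Y z) v) = v :=
    congrArg (fun S : H →L[ℂ] H => S v) (Ring.mul_inverse_cancel _ hw)
  have h2 : ∀ y, inner ℂ x (weight Y z y) = z.1 * inner ℂ x y := by
    intro y
    have h3 : inner ℂ x (Y y) = inner ℂ x y := by
      have := hY x y
      simp only [ContinuousLinearMap.coe_coe, hx] at this
      exact this.symm
    simp [weight, h3]
  rw [eq_inv_mul_iff_mul_eq₀ hz, ← h2, h]

/-- The case `q = M` is included because the last factor applied is `A`: only vectors with exponent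
below `M` meet `z_Y⁻¹`. -/
theorem imageMoment_eq {A Y : H →L[ℂ] H} {α : H} {M : ℕ}
    (hfix : ∀ q < M, Y ((A ^ q) α) = (A ^ q) α) {z : ℂ × ℂ} (hw : IsUnit (weight Y z))
    (hz : z.1 ≠ 0) {q : ℕ} (hq : q ≤ M) :
    imageMoment A Y α q z = (z.1⁻¹) ^ q • (A ^ q) α := by
  induction q with
  | zero => simp [imageMoment]
  | succ q ih =>
    have h := ih (by omega)
    rw [imageMoment] at h ⊢
    rw [pow_succ', mul_apply_eq_comp, h, mul_apply_eq_comp, map_smul,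
      inverse_weight_apply_of_fixed hw hz (hfix q (by omega)), map_smul, map_smul, smul_smul,
      ← pow_succ, pow_succ' A, mul_apply_eq_comp]

theorem inner_pow_apply_eq {A Y : H →L[ℂ] H} (hA : (A : H →ₗ[ℂ] H).IsSymmetric)
    (hY : (Y : H →ₗ[ℂ] H).IsSymmetric) {α : H} {M : ℕ}
    (hfix : ∀ q < M, Y ((A ^ q) α) = (A ^ q) α) {z : ℂ × ℂ} (hw : IsUnit (weight Y z))
    (hz : z.1 ≠ 0) {p : ℕ} (hp : p ≤ M) (v : H) :
    inner ℂ α (((Ring.inverse (weight Y z) * A) ^ p) v) =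
      (z.1⁻¹) ^ p * inner ℂ ((A ^ p) α) v := by
  induction p generalizing v with
  | zero => simp
  | succ p ih =>
    have h3 : inner ℂ ((A ^ p) α) (A v) = inner ℂ ((A ^ (p + 1)) α) v := by
      rw [pow_succ' A]
      exact (hA _ v).symm
    rw [pow_succ, mul_apply_eq_comp, ih (by omega), mul_apply_eq_comp,
      inner_inverse_weight_of_fixed hY hw hz (hfix p (by omega)), h3]
    ring

/-- Peeling `p` factors from the left and `q` from the right leaves a single `z_Y⁻¹` in the middle.
With `p = q = M` this reaches the first term that can see `Y`. -/
theorem seriesTerm_eq {A Y : H →L[ℂ] H} (hA : (A : H →ₗ[ℂ] H).IsSymmetric)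
    (hY : (Y : H →ₗ[ℂ] H).IsSymmetric) {α : H} {M : ℕ}
    (hfix : ∀ q < M, Y ((A ^ q) α) = (A ^ q) α) {z : ℂ × ℂ} (hw : IsUnit (weight Y z))
    (hz : z.1 ≠ 0) {p q : ℕ} (hp : p ≤ M) (hq : q ≤ M) :
    seriesTerm A Y α (p + q) z = (z.1⁻¹) ^ (p + q) *
      inner ℂ ((A ^ p) α) (Ring.inverse (weight Y z) ((A ^ q) α)) := by
  have h : ∀ B : H →L[ℂ] H, B * (A * B) ^ (p + q) = (B * A) ^ p * (B * (A * B) ^ q) := by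
    intro B
    have h1 : ∀ k : ℕ, B * (A * B) ^ k = (B * A) ^ k * B := by
      intro k
      induction k with
      | zero => simp
      | succ k ih => rw [pow_succ, ← mul_assoc, ih, pow_succ]; simp only [mul_assoc]
    rw [pow_add, ← mul_assoc, h1 p, mul_assoc]
  have h2 := imageMoment_eq hfix hw hz hq
  rw [imageMoment] at h2
  rw [seriesTerm, h, mul_apply_eq_comp, inner_pow_apply_eq hA hY hfix hw hz hp,
    mul_apply_eq_comp, h2, map_smul, inner_smul_right]
  ring

theorem inner_pow_pow {A : H →L[ℂ] H} (hA : (A : H →ₗ[ℂ] H).IsSymmetric) (α : H) (p q : ℕ) :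
    inner ℂ ((A ^ p) α) ((A ^ q) α) = inner ℂ α ((A ^ (p + q)) α) := by
  induction p generalizing q with
  | zero => simp
  | succ p ih =>
    have h3 : inner ℂ ((A ^ (p + 1)) α) ((A ^ q) α) = inner ℂ ((A ^ p) α) (A ((A ^ q) α)) := by
      rw [pow_succ' A]
      exact hA _ _
    rw [h3, ← mul_apply_eq_comp, ← pow_succ', ih]
    congr 3
    ring

theorem seriesTerm_eq_of_lt {A Y : H →L[ℂ] H} (hA : (A : H →ₗ[ℂ] H).IsSymmetric)
    (hY : (Y : H →ₗ[ℂ] H).IsSymmetric) {α : H} {M : ℕ}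
    (hfix : ∀ q < M, Y ((A ^ q) α) = (A ^ q) α) {z : ℂ × ℂ} (hw : IsUnit (weight Y z))
    (hz : z.1 ≠ 0) {k : ℕ} (hk : k < 2 * M) :
    seriesTerm A Y α k z = inner ℂ α ((A ^ k) α) / z.1 ^ (k + 1) := by
  obtain ⟨p, q, hp, hq, rfl⟩ : ∃ p q, p ≤ M ∧ q < M ∧ p + q = k :=
    -- Here `q < M` is strict, so the middle `z_Y⁻¹` also acts as `1 / z₁`.
    ⟨k - k / 2, k / 2, by omega, by omega, by omega⟩
  rw [seriesTerm_eq hA hY hfix hw hz hp hq.le,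
    inverse_weight_apply_of_fixed hw hz (hfix q hq), inner_smul_right, inner_pow_pow hA, pow_succ]
  rw [inv_pow, div_eq_mul_inv, mul_inv]
  ring

/-- For real `b` the conjugation in the first slot leaves the powers of `1 / b₁` unchanged, so both
sides reduce to the same middle form. -/
theorem scalarMoment_eq_seriesTerm {A Y : H →L[ℂ] H} (hA : (A : H →ₗ[ℂ] H).IsSymmetric)
    (hY : (Y : H →ₗ[ℂ] H).IsSymmetric) {α : H} {M : ℕ}
    (hfix : ∀ q < M, Y ((A ^ q) α) = (A ^ q) α) {b : ℝ × ℝ}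
    (hw : IsUnit (weight Y ((b.1 : ℂ), (b.2 : ℂ)))) (hb : 0 < b.1) {k : ℕ} (hk : 1 ≤ k)
    (hkM : k ≤ 2 * M + 1) :
    scalarMoment A Y α k b = seriesTerm A Y α (k - 1) ((b.1 : ℂ), (b.2 : ℂ)) := by
  have hz : (((b.1 : ℂ), (b.2 : ℂ)) : ℂ × ℂ).1 ≠ 0 := by
    simpa using hb.ne'
  obtain ⟨p, q, hp, hq, hpk, hqk⟩ : ∃ p q, p ≤ M ∧ q ≤ M ∧ k / 2 = p ∧ (k + 1) / 2 = q + 1 :=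
    ⟨k / 2, (k + 1) / 2 - 1, by omega, by omega, rfl, by omega⟩
  have hk' : k - 1 = p + q := by omega
  have hv : vectorMoment A Y α (q + 1) ((b.1 : ℂ), (b.2 : ℂ)) =
      Ring.inverse (weight Y ((b.1 : ℂ), (b.2 : ℂ)))
        (imageMoment A Y α q ((b.1 : ℂ), (b.2 : ℂ))) := by
    rw [vectorMoment, imageMoment, ← mul_apply_eq_comp, ← mul_apply_eq_comp]
    congr 1
    generalize Ring.inverse (weight Y ((b.1 : ℂ), (b.2 : ℂ))) = B
    rw [Nat.add_sub_cancel]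
    clear * -
    induction q with
    | zero => simp
    | succ k ih => rw [pow_succ', mul_assoc, ih, pow_succ']; simp only [mul_assoc]
  rw [hk', seriesTerm_eq hA hY hfix hw hz hp hq, scalarMoment, hpk, hqk, hv,
    imageMoment_eq hfix hw hz hp, imageMoment_eq hfix hw hz hq, map_smul, inner_smul_left,
    inner_smul_right]
  simp only [map_pow, map_inv₀, Complex.conj_ofReal]
  ring

end Resolvent

/-! ### Nontangential expansions and their uniqueness along rays. -/

theorem isBigO_inv_mul_pow (c : ℝ) (p q : ℕ) :
    (fun z : ℂ × ℂ => 1 / (z.1 ^ p * z.2 ^ q)) =O[nontangential c]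
      (fun z => 1 / ‖z‖ ^ (p + q)) := by
  refine IsBigO.of_bound (|c| ^ p * |c| ^ q) (mem_inf_of_right ?_)
  rintro z ⟨hz, hzc⟩
  have hμ := lt_min hz.1 hz.2
  have hz1 : 0 < ‖z.1‖ := hz.1.trans_le (Complex.im_le_norm _)
  have hz2 : 0 < ‖z.2‖ := hz.2.trans_le (Complex.im_le_norm _)
  have hz0 : 0 < ‖z‖ := hz1.trans_le (norm_fst_le z)
  have hb : ∀ x : ℝ, min z.1.im z.2.im ≤ x → ‖z‖ ≤ |c| * x := fun x hx =>
    hzc.trans ((mul_le_mul_of_nonneg_right (le_abs_self c) hμ.le).trans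
      (mul_le_mul_of_nonneg_left hx (abs_nonneg c)))
  have h1 := hb _ ((min_le_left _ _).trans (Complex.im_le_norm z.1))
  have h2 := hb _ ((min_le_right _ _).trans (Complex.im_le_norm z.2))
  show ‖1 / (z.1 ^ p * z.2 ^ q)‖ ≤ |c| ^ p * |c| ^ q * ‖1 / ‖z‖ ^ (p + q)‖
  rw [Real.norm_of_nonneg (by positivity), norm_div, norm_mul, norm_pow, norm_pow, norm_one,
    mul_one_div, div_le_div_iff₀ (by positivity) (by positivity), one_mul]
  calc ‖z‖ ^ (p + q) = ‖z‖ ^ p * ‖z‖ ^ q := pow_add _ _ _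
    _ ≤ (|c| * ‖z.1‖) ^ p * (|c| * ‖z.2‖) ^ q := by gcongr
    _ = _ := by ring

/-- The homogeneous part of degree `-k` of `expansion ρ M`. -/
def expansionPart (ρ : ℕ × ℕ → ℝ) (k : ℕ) (z : ℂ × ℂ) : ℂ :=
  ∑ n ∈ Finset.HasAntidiagonal.antidiagonal k, (ρ n : ℂ) / (z.1 ^ n.1 * z.2 ^ n.2)

theorem expansion_eq_sum (ρ : ℕ × ℕ → ℝ) (M : ℕ) (z : ℂ × ℂ) :
    expansion ρ M z = ∑ k ∈ Finset.range (M + 1), expansionPart ρ k z := rfl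

theorem expansionPart_isBigO (ρ : ℕ × ℕ → ℝ) (k : ℕ) (c : ℝ) :
    expansionPart ρ k =O[nontangential c] (fun z => 1 / ‖z‖ ^ k) := by
  unfold expansionPart
  refine IsBigO.fun_sum fun n hn => ?_
  rw [Finset.HasAntidiagonal.mem_antidiagonal] at hn
  simpa [div_eq_mul_inv, hn] using (isBigO_inv_mul_pow c n.1 n.2).const_mul_left (ρ n : ℂ)

theorem LoewnerClass_subset (N : ℕ) (hN : 1 ≤ N) :
    LoewnerClass N ⊆ IntermediateLoewnerClass N := by
  rintro h ⟨h1, h2, ρ, h3⟩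
  refine ⟨h1, h2, ρ, fun c => ?_⟩
  have h4 := (h3 c).isBigO.add (expansionPart_isBigO ρ (2 * N - 1) c)
  refine h4.congr_left fun z => ?_
  obtain ⟨j, hj⟩ : ∃ j, 2 * N - 1 = j + 1 := ⟨2 * N - 2, by omega⟩
  rw [show 2 * N - 2 = j by omega, hj, expansion_eq_sum, expansion_eq_sum,
    Finset.sum_range_succ _ (j + 1)]
  ring

/-- The ray `s ↦ s i b`. -/
def ray (b : ℝ × ℝ) (s : ℝ) : ℂ × ℂ := ((s : ℂ) * Complex.I) • ((b.1 : ℂ), (b.2 : ℂ))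

theorem norm_ray (b : ℝ × ℝ) (s : ℝ) : ‖ray b s‖ = |s| * ‖b‖ := by
  rw [ray, norm_smul, norm_mul, Complex.norm_I, mul_one, Complex.norm_real, Real.norm_eq_abs]
  simp [Prod.norm_def]

theorem tendsto_ray {b : ℝ × ℝ} (h1 : 0 < b.1) (h2 : 0 < b.2) :
    Tendsto (ray b) atTop (nontangential (‖b‖ / min b.1 b.2)) := by
  have hμ := lt_min h1 h2
  have hb : 0 < ‖b‖ := norm_pos_iff.2 (by rintro rfl; simp at h1)
  refine tendsto_inf.2 ⟨?_, tendsto_principal.2 ?_⟩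
  · rw [← tendsto_norm_atTop_iff_cobounded]
    simp only [norm_ray]
    exact tendsto_abs_atTop_atTop.atTop_mul_const hb
  · filter_upwards [eventually_gt_atTop 0] with s hs
    have e1 : (ray b s).1.im = s * b.1 := by simp [ray]
    have e2 : (ray b s).2.im = s * b.2 := by simp [ray]
    refine ⟨⟨by rw [e1]; positivity, by rw [e2]; positivity⟩, ?_⟩
    rw [norm_ray, e1, e2, ← mul_min_of_nonneg _ _ hs.le, abs_of_pos hs]
    apply le_of_eq
    field_simp

theorem coeff_eq_zero_of_isLittleO (c : ℕ → ℂ) (M : ℕ)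
    (h : (fun s : ℝ => ∑ k ∈ Finset.range (M + 1), c k / (s : ℂ) ^ k) =o[atTop]
      (fun s : ℝ => 1 / s ^ M)) : ∀ k ≤ M, c k = 0 := by
  induction M with
  | zero =>
    have h0 : c 0 = 0 := by
      simpa [isLittleO_const_const_iff] using h
    intro k hk
    rwa [Nat.le_zero.1 hk]
  | succ M ih =>
    have hz : (fun s : ℝ => 1 / s ^ (M + 1)) =o[atTop] (fun s : ℝ => 1 / s ^ M) := by
      refine (isLittleO_iff_tendsto' ?_).2 ?_
      · filter_upwards [eventually_gt_atTop 0] with s hs h0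
        simp [hs.ne'] at h0
      · refine tendsto_inv_atTop_zero.congr' ?_
        filter_upwards [eventually_gt_atTop 0] with s hs
        rw [pow_succ]
        field_simp
    have hlast : (fun s : ℝ => c (M + 1) / (s : ℂ) ^ (M + 1)) =O[atTop]
        (fun s : ℝ => 1 / s ^ (M + 1)) := by
      refine IsBigO.of_bound ‖c (M + 1)‖ (Eventually.of_forall fun s => ?_)
      simp [div_eq_mul_inv]
    -- Weakening the error to `o(1 / s^M)` absorbs the top term; once the lower coefficients vanish,
    -- the original estimate isolates the top one.
    have hlow : ∀ k ≤ M, c k = 0 := by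
      refine ih (((h.trans hz).sub (hlast.trans_isLittleO hz)).congr_left fun s => ?_)
      rw [Finset.sum_range_succ _ (M + 1)]
      ring
    have htop : c (M + 1) = 0 := by
      have h2 : (fun s : ℝ => c (M + 1) / (s : ℂ) ^ (M + 1)) =o[atTop]
          (fun s : ℝ => 1 / s ^ (M + 1)) := by
        refine h.congr_left fun s => ?_
        rw [Finset.sum_range_succ, Finset.sum_eq_zero, zero_add]
        intro k hk
        rw [hlow k (by simpa [Nat.lt_succ_iff] using hk), zero_div]
      have h3 : (fun _ : ℝ => c (M + 1)) =o[atTop] (fun _ : ℝ => (1 : ℝ)) := by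
        have h4 : (fun s : ℝ => (s : ℂ) ^ (M + 1)) =O[atTop] (fun s : ℝ => s ^ (M + 1)) :=
          IsBigO.of_bound 1 (Eventually.of_forall fun s => by simp)
        refine (h2.mul_isBigO h4).congr' ?_ ?_
        all_goals
          filter_upwards [eventually_gt_atTop 0] with s hs
          have hs' : (s : ℂ) ≠ 0 := by exact_mod_cast hs.ne'
          field_simp
      simpa [isLittleO_const_const_iff] using h3
    intro k hk
    rcases hk.lt_or_eq with hk | rfl
    · exact hlow k (by omega)
    · exact htop

theorem isPolynomial_expansionPart (ρ : ℕ × ℕ → ℝ) (k : ℕ) :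
    IsPolynomialInInverses fun b => expansionPart ρ k ((b.1 : ℂ), (b.2 : ℂ)) := by
  refine ⟨∑ n ∈ Finset.HasAntidiagonal.antidiagonal k,
    MvPolynomial.C (ρ n : ℂ) * (MvPolynomial.X 0 ^ n.1 * MvPolynomial.X 1 ^ n.2), fun b _ _ => ?_⟩
  simp [expansionPart, div_eq_mul_inv, mul_comm]

theorem IsPolynomialInInverses.neg {r : ℝ × ℝ → ℂ} (h : IsPolynomialInInverses r) :
    IsPolynomialInInverses fun b => -r b := by
  obtain ⟨p, hp⟩ := h
  exact ⟨-p, fun b h1 h2 => by rw [map_neg, ← hp b h1 h2]⟩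

/-- If `h` has an expansion in homogeneous functions and belongs to `𝓛^N`, then the part of degree
`-(2N-1)` is a polynomial in the inverses. -/
theorem isPolynomial_of_mem_LoewnerClass {N : ℕ} {h : ℂ × ℂ → ℂ} (hh : h ∈ LoewnerClass N)
    {g : ℕ → ℂ × ℂ → ℂ} (hg : ∀ k (l : ℂ) z, l ≠ 0 → g k (l • z) = g k z / l ^ k)
    (hexp : ∀ c : ℝ, (fun z => h z - ∑ k ∈ Finset.range (2 * N - 1 + 1), g k z)
      =o[nontangential c] (fun z => 1 / ‖z‖ ^ (2 * N - 1))) :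
    IsPolynomialInInverses fun b => g (2 * N - 1) ((b.1 : ℂ), (b.2 : ℂ)) := by
  obtain ⟨-, -, ρ, hρ⟩ := hh
  obtain ⟨p, hp⟩ := isPolynomial_expansionPart ρ (2 * N - 1)
  refine ⟨p, fun b h1 h2 => ?_⟩
  rw [← hp b h1 h2]
  have hdiff := ((hρ _).sub (hexp _)).comp_tendsto (tendsto_ray h1 h2)
  set B : ℂ × ℂ := ((b.1 : ℂ), (b.2 : ℂ))
  have hpart : ∀ k (l : ℂ) z, l ≠ 0 → expansionPart ρ k (l • z) = expansionPart ρ k z / l ^ k := by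
    intro k l z hl
    rw [expansionPart, expansionPart, Finset.sum_div]
    refine Finset.sum_congr rfl fun n hn => ?_
    rw [← Finset.HasAntidiagonal.mem_antidiagonal.1 hn, div_div]
    simp only [Prod.smul_fst, Prod.smul_snd, smul_eq_mul]
    ring
  -- On the ray, homogeneity turns the difference of the two expansions into a polynomial in `1 /
  -- s`.
  have h3 : (fun s : ℝ => ∑ k ∈ Finset.range (2 * N - 1 + 1),
      ((g k B - expansionPart ρ k B) / Complex.I ^ k) / (s : ℂ) ^ k) =o[atTop]
      (fun s : ℝ => 1 / s ^ (2 * N - 1)) := by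
    refine (hdiff.congr' ?_ (EventuallyEq.refl _ _)).trans_isBigO ?_
    · filter_upwards [eventually_gt_atTop 0] with s hs
      have hs' : (s : ℂ) * Complex.I ≠ 0 :=
        mul_ne_zero (by exact_mod_cast hs.ne') Complex.I_ne_zero
      simp only [Function.comp, ray, expansion_eq_sum]
      rw [sub_sub_sub_cancel_left, ← Finset.sum_sub_distrib]
      refine Finset.sum_congr rfl fun k _ => ?_
      rw [hg k _ _ hs', hpart k _ _ hs', mul_pow]
      field_simp
      rfl
    · refine IsBigO.of_bound (1 / ‖b‖ ^ (2 * N - 1)) (Eventually.of_forall fun s => ?_)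
      simp [norm_ray, mul_pow, mul_comm]
  have h4 := coeff_eq_zero_of_isLittleO _ _ h3 _ le_rfl
  rw [div_eq_zero_iff, or_iff_left (pow_ne_zero _ Complex.I_ne_zero), sub_eq_zero] at h4
  exact h4

/-- At `b = (1, 1/x)` a polynomial `Q(x)` would satisfy `(Q - C)(t x + 1 - t) = D x` for all `x >
0`, hence identically; at `x = -(1 - t)/t` the left side vanishes and the right side does not. -/
theorem not_isPolynomial_inv_mix {t : ℝ} (ht0 : 0 < t) (ht1 : t < 1) (C : ℂ) {D : ℂ} (hD : D ≠ 0)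
    (p q : ℕ) : ¬ IsPolynomialInInverses fun b =>
      C / (b.1 : ℂ) ^ p + D / ((b.1 : ℂ) ^ q * (t * b.1 + (1 - t) * b.2)) := by
  rintro ⟨P, hP⟩
  set Q : Polynomial ℂ := MvPolynomial.aeval ![(1 : Polynomial ℂ), Polynomial.X] P with hQ
  have hQe : ∀ x : ℂ, Q.eval x = MvPolynomial.eval ![1, x] P := by
    intro x
    rw [hQ, ← Polynomial.coe_aeval_eq_eval, ← AlgHom.comp_apply, MvPolynomial.comp_aeval,
      MvPolynomial.aeval_eq_eval]
    congr 2
    ext i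
    fin_cases i <;> simp
  set R : Polynomial ℂ := (Q - Polynomial.C C) * (Polynomial.C (t : ℂ) * Polynomial.X +
    Polynomial.C (1 - t : ℂ)) - Polynomial.C D * Polynomial.X with hR
  have hR0 : R = 0 := by
    refine Polynomial.eq_zero_of_infinite_isRoot R
      (((Set.Ioi_infinite (0 : ℝ)).image Complex.ofReal_injective.injOn).mono ?_)
    rintro _ ⟨x, hx, rfl⟩
    have hx : 0 < x := hx
    have hxc : (x : ℂ) ≠ 0 := by exact_mod_cast hx.ne'
    have h1 := hP (1, x⁻¹) one_pos (inv_pos.2 hx)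
    have h2 : (t : ℂ) * x + (1 - t) ≠ 0 := by
      have : 0 < t * x + (1 - t) := by nlinarith [mul_pos ht0 hx]
      exact_mod_cast this.ne'
    have h3 : (t : ℂ) + (1 - t) * (x : ℂ)⁻¹ ≠ 0 := by
      intro h
      apply h2
      have := congrArg (· * (x : ℂ)) h
      simp only [add_mul, mul_assoc, inv_mul_cancel₀ hxc, zero_mul, mul_one] at this
      exact this
    simp only [Complex.ofReal_one, one_pow, div_one, mul_one, one_mul, Complex.ofReal_inv,
      one_div, inv_inv] at h1
    show R.eval (x : ℂ) = 0
    rw [hR]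
    simp only [Polynomial.eval_sub, Polynomial.eval_mul, Polynomial.eval_add, Polynomial.eval_C,
      Polynomial.eval_X, hQe]
    rw [← h1]
    field_simp
    ring
  have h1 := congrArg (Polynomial.eval (-(1 - t : ℂ) / t)) hR0
  have ht : (t : ℂ) ≠ 0 := by exact_mod_cast ht0.ne'
  have ht' : (1 - t : ℂ) ≠ 0 := by
    have : (1 - t) ≠ 0 := by linarith
    exact_mod_cast this
  rw [hR] at h1
  simp only [Polynomial.eval_sub, Polynomial.eval_mul, Polynomial.eval_add, Polynomial.eval_C,
      Polynomial.eval_X, Polynomial.eval_zero, mul_div_cancel₀ _ ht, neg_add_cancel, mul_zero,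
      zero_sub, neg_eq_zero, mul_eq_zero, hD, div_eq_zero_iff, ht, ht', or_false] at h1

/-! ### Walks on the cycle. -/

section Walks

variable {m : ℕ} [NeZero m]

theorem leftRegular_apply (j : ZMod m) (v : EuclideanSpace ℂ (ZMod m)) (i : ZMod m) :
    leftRegular j v i = v (-j + i) := by
  simp [leftRegular]

theorem exampleA_apply (v : EuclideanSpace ℂ (ZMod m)) (i : ZMod m) :
    exampleA m v i = v (i - 1) + v (i + 1) := by
  simp only [exampleA, add_apply, PiLp.add_apply, leftRegular_apply]
  rw [neg_add_eq_sub, neg_neg, add_comm 1 i]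

theorem exampleY_apply (j : ZMod m) (t : ℝ) (v : EuclideanSpace ℂ (ZMod m)) (i : ZMod m) :
    exampleY j t v i = (if i = j then (t : ℂ) else 1) * v i := by
  simp [exampleY, Matrix.mulVec_diagonal]

theorem exampleA_isSymmetric :
    (exampleA m : EuclideanSpace ℂ (ZMod m) →ₗ[ℂ] EuclideanSpace ℂ (ZMod m)).IsSymmetric := by
  intro u v
  simp only [ContinuousLinearMap.coe_coe, PiLp.inner_apply, exampleA_apply, inner_add_left,
    inner_add_right, Finset.sum_add_distrib]
  rw [add_comm]
  congr 1
  · exact Fintype.sum_equiv (Equiv.addRight 1) _ _ fun i => by simp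
  · exact Fintype.sum_equiv (Equiv.subRight 1) _ _ fun i => by simp

theorem isPositive_of_diagonal (T : EuclideanSpace ℂ (ZMod m) →L[ℂ] EuclideanSpace ℂ (ZMod m))
    (d : ZMod m → ℝ) (hd : ∀ i, 0 ≤ d i) (h : ∀ v i, T v i = (d i : ℂ) * v i) :
    T.IsPositive := by
  refine ⟨fun u v => ?_, fun u => ?_⟩
  · simp only [ContinuousLinearMap.coe_coe, PiLp.inner_apply, h]
    refine Finset.sum_congr rfl fun i _ => ?_
    simp
    ring
  · rw [ContinuousLinearMap.reApplyInnerSelf_apply, PiLp.inner_apply, map_sum]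
    refine Finset.sum_nonneg fun i _ => ?_
    rw [h]
    have : inner ℂ ((d i : ℂ) * u i) (u i) = ((d i * ‖u i‖ ^ 2 : ℝ) : ℂ) := by
      rw [← smul_eq_mul, inner_smul_left, inner_self_eq_norm_sq_to_K]
      simp
    rw [this]
    exact mul_nonneg (hd i) (sq_nonneg ‖u i‖)

theorem exampleY_isPositive (j : ZMod m) {t : ℝ} (ht : 0 ≤ t) : (exampleY j t).IsPositive := by
  refine isPositive_of_diagonal _ (fun i => if i = j then t else 1) (fun i => ?_) fun v i => ?_
  · split_ifs <;> simp [ht]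
  · rw [exampleY_apply]
    split_ifs <;> simp

theorem one_sub_exampleY_isPositive (j : ZMod m) {t : ℝ} (ht : t ≤ 1) :
    (1 - exampleY j t).IsPositive := by
  refine isPositive_of_diagonal _ (fun i => if i = j then 1 - t else 0) (fun i => ?_) fun v i => ?_
  · split_ifs <;> simp [ht]
  · have : (1 - exampleY j t) v i = v i - exampleY j t v i := rfl
    rw [this, exampleY_apply]
    split_ifs <;> simp [sub_mul]

/-- The number of walks of length `q` from `0` to `i` on the cycle `ℤ / m`. -/
def walks (m : ℕ) : ℕ → ZMod m → ℕ
  | 0, i => if i = 0 then 1 else 0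
  | q + 1, i => walks m q (i - 1) + walks m q (i + 1)

theorem exampleA_pow_apply (q : ℕ) (i : ZMod m) :
    ((exampleA m) ^ q) (EuclideanSpace.single 0 1) i = (walks m q i : ℂ) := by
  induction q generalizing i with
  | zero => simp [walks]
  | succ q ih => rw [pow_succ', mul_apply_eq_comp, exampleA_apply, ih, ih, walks, Nat.cast_add]

theorem exists_of_walks_ne_zero {m : ℕ} (q : ℕ) (i : ZMod m) (h : walks m q i ≠ 0) :
    ∃ k : ℤ, |k| ≤ q ∧ (k : ZMod m) = i := by
  induction q generalizing i with
  | zero =>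
    refine ⟨0, by simp, ?_⟩
    by_contra hi
    exact h (if_neg fun h' => hi (by simp [h']))
  | succ q ih =>
    have h' : walks m q (i - 1) ≠ 0 ∨ walks m q (i + 1) ≠ 0 := by
      by_contra hc
      push Not at hc
      exact h (by rw [walks, hc.1, hc.2])
    rcases h' with h' | h'
    · obtain ⟨k, hk, hki⟩ := ih _ h'
      rw [abs_le] at hk
      exact ⟨k + 1, abs_le.2 ⟨by push_cast; linarith, by push_cast; linarith⟩,
        by push_cast; rw [hki]; ring⟩
    · obtain ⟨k, hk, hki⟩ := ih _ h'
      rw [abs_le] at hk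
      exact ⟨k - 1, abs_le.2 ⟨by push_cast; linarith, by push_cast; linarith⟩,
        by push_cast; rw [hki]; ring⟩

theorem walks_pos {m : ℕ} (q : ℕ) : 0 < walks m q (q : ZMod m) := by
  induction q with
  | zero => simp [walks]
  | succ q ih =>
    rw [walks]
    refine Nat.add_pos_left ?_ _
    simpa using ih

theorem walks_antipode_eq_zero {M : ℕ} [NeZero (2 * M)] {q : ℕ} (hq : q < M) :
    walks (2 * M) q (M : ZMod (2 * M)) = 0 := by
  by_contra h
  obtain ⟨k, hk, hkM⟩ := exists_of_walks_ne_zero q _ h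
  rw [abs_le] at hk
  have h1 : ((2 * M : ℕ) : ℤ) ∣ (M : ℤ) - k :=
    (ZMod.intCast_eq_intCast_iff_dvd_sub k M (2 * M)).1 (by simpa using hkM)
  -- Since `|k| < M`, the difference `M - k` lies strictly between `0` and `2M`.
  have h2 := Int.le_of_dvd (by omega) h1
  push_cast at h2
  omega

theorem exampleY_fixed {M : ℕ} [NeZero (2 * M)] (t : ℝ) {q : ℕ} (hq : q < M) :
    exampleY (M : ZMod (2 * M)) t (((exampleA (2 * M)) ^ q) (EuclideanSpace.single 0 1)) =
      ((exampleA (2 * M)) ^ q) (EuclideanSpace.single 0 1) := by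
  ext i
  rw [exampleY_apply, exampleA_pow_apply]
  split_ifs with h
  · rw [h, walks_antipode_eq_zero hq]
    simp
  · rw [one_mul]

theorem inverse_weight_exampleY_apply (j : ZMod m) (t : ℝ) {z : ℂ × ℂ}
    (hw : IsUnit (weight (exampleY j t) z)) (hz : z.1 ≠ 0) (hz' : t * z.1 + (1 - t) * z.2 ≠ 0)
    (v : EuclideanSpace ℂ (ZMod m)) (i : ZMod m) :
    Ring.inverse (weight (exampleY j t) z) v i =
      if i = j then v i / (t * z.1 + (1 - t) * z.2) else v i / z.1 := by
  set u := Ring.inverse (weight (exampleY j t) z) v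
  have h : weight (exampleY j t) z u = v :=
    congrArg (fun S : EuclideanSpace ℂ (ZMod m) →L[ℂ] EuclideanSpace ℂ (ZMod m) => S v)
      (Ring.mul_inverse_cancel _ hw)
  have h2 : z.1 * exampleY j t u i + z.2 * (u i - exampleY j t u i) = v i := by
    rw [← h]
    rfl
  rw [exampleY_apply] at h2
  split_ifs at h2 ⊢ with hi
  · rw [eq_div_iff hz', ← h2]
    ring
  · rw [eq_div_iff hz, ← h2]
    ring

end Walks

/-- The coefficient of `1 / z₁^(2M+1)` in the first nonpolynomial term of the Neumann series. -/
def restCoeff (M : ℕ) [NeZero (2 * M)] : ℂ :=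
  ∑ i ∈ Finset.univ.erase (M : ZMod (2 * M)), (walks (2 * M) M i : ℂ) ^ 2

/-- The coefficient of `1 / (z₁^(2M) (t z₁ + (1 - t) z₂))` in the first nonpolynomial term of the
Neumann series. -/
def antipodeCoeff (M : ℕ) : ℂ := (walks (2 * M) M (M : ZMod (2 * M)) : ℂ) ^ 2

theorem antipodeCoeff_ne_zero (M : ℕ) [NeZero (2 * M)] : antipodeCoeff M ≠ 0 :=
  pow_ne_zero _ (Nat.cast_ne_zero.2 (walks_pos M).ne')

/-! ### The expansion of the example. -/

section Series

variable {M : ℕ} [NeZero (2 * M)] {t : ℝ}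

theorem seriesTerm_example_of_lt {z : ℂ × ℂ}
    (hw : IsUnit (weight (exampleY (M : ZMod (2 * M)) t) z)) (ht : 0 ≤ t) (hz : z.1 ≠ 0) {k : ℕ}
    (hk : k < 2 * M) :
    seriesTerm (exampleA (2 * M)) (exampleY (M : ZMod (2 * M)) t) (EuclideanSpace.single 0 1) k z =
      (walks (2 * M) k 0 : ℂ) / z.1 ^ (k + 1) := by
  rw [seriesTerm_eq_of_lt exampleA_isSymmetric (exampleY_isPositive _ ht).isSymmetric
    (fun q hq => exampleY_fixed t hq) hw hz hk, EuclideanSpace.inner_single_left,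
    exampleA_pow_apply]
  simp

theorem seriesTerm_example_top {z : ℂ × ℂ}
    (hw : IsUnit (weight (exampleY (M : ZMod (2 * M)) t) z)) (ht : 0 ≤ t) (hz : z.1 ≠ 0)
    (hz' : t * z.1 + (1 - t) * z.2 ≠ 0) :
    seriesTerm (exampleA (2 * M)) (exampleY (M : ZMod (2 * M)) t) (EuclideanSpace.single 0 1)
      (2 * M) z = restCoeff M / z.1 ^ (2 * M + 1) +
        antipodeCoeff M / (z.1 ^ (2 * M) * (t * z.1 + (1 - t) * z.2)) := by
  have h := seriesTerm_eq exampleA_isSymmetric (exampleY_isPositive _ ht).isSymmetric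
    (fun q hq => exampleY_fixed t hq) hw hz le_rfl (le_refl M)
  rw [← two_mul] at h
  -- The antipodal coordinate is split off: there `z_Y⁻¹` divides by `t z₁ + (1 - t) z₂`, elsewhere
  -- by `z₁`.
  rw [h, PiLp.inner_apply,
    ← Finset.add_sum_erase _ _ (Finset.mem_univ (M : ZMod (2 * M)))]
  have h1 : ∀ i ∈ Finset.univ.erase (M : ZMod (2 * M)),
      inner ℂ (((exampleA (2 * M)) ^ M) (EuclideanSpace.single 0 1) i)
        (Ring.inverse (weight (exampleY (M : ZMod (2 * M)) t) z)
          (((exampleA (2 * M)) ^ M) (EuclideanSpace.single 0 1)) i) =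
        (walks (2 * M) M i : ℂ) ^ 2 / z.1 := by
    intro i hi
    rw [inverse_weight_exampleY_apply _ _ hw hz hz', if_neg (Finset.ne_of_mem_erase hi),
      exampleA_pow_apply]
    simp
    ring
  rw [Finset.sum_congr rfl h1, inverse_weight_exampleY_apply _ _ hw hz hz', if_pos rfl,
    exampleA_pow_apply, ← Finset.sum_div, ← restCoeff, pow_succ, antipodeCoeff, inv_pow]
  simp only [RCLike.inner_apply, map_natCast]
  field_simp
  ring

theorem mix_ne_zero_of_mem_biUpper (ht0 : 0 ≤ t) (ht1 : t < 1) {z : ℂ × ℂ} (hz : z ∈ biUpper) :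
    t * z.1 + (1 - t) * z.2 ≠ 0 := by
  intro h
  have h1 := congrArg Complex.im h
  have h2 : ((t : ℂ) * z.1 + (1 - t) * z.2).im = t * z.1.im + (1 - t) * z.2.im := by simp
  rw [h2, Complex.zero_im] at h1
  nlinarith [mul_nonneg ht0 hz.1.le, mul_pos (sub_pos.2 ht1) hz.2]

theorem fst_ne_zero_of_mem_biUpper {z : ℂ × ℂ} (hz : z ∈ biUpper) : z.1 ≠ 0 := by
  intro h
  have := hz.1
  simp [h] at this

theorem isUnit_weight_of_mem_biUpper (ht0 : 0 ≤ t) (ht1 : t ≤ 1) {z : ℂ × ℂ} (hz : z ∈ biUpper) :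
    IsUnit (weight (exampleY (M : ZMod (2 * M)) t) z) :=
  (isUnit_of_coercive _ (lt_min hz.1 hz.2)
    (weight_coercive (exampleY_isPositive _ ht0) (one_sub_exampleY_isPositive _ ht1) z)).1

theorem isPolynomial_scalarMoment_example (ht0 : 0 ≤ t) (ht1 : t ≤ 1) {k : ℕ} (hk : 1 ≤ k)
    (hkM : k ≤ 2 * M) : IsPolynomialInInverses (scalarMoment (exampleA (2 * M))
      (exampleY (M : ZMod (2 * M)) t) (EuclideanSpace.single 0 1) k) := by
  refine ⟨MvPolynomial.C (walks (2 * M) (k - 1) 0 : ℂ) * MvPolynomial.X 0 ^ k,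
    fun b h1 h2 => ?_⟩
  have hw := isUnit_weight_ofReal (exampleY_isPositive (M : ZMod (2 * M)) ht0)
    (one_sub_exampleY_isPositive _ ht1) h1 h2
  rw [scalarMoment_eq_seriesTerm exampleA_isSymmetric (exampleY_isPositive _ ht0).isSymmetric
    (fun q hq => exampleY_fixed t hq) hw h1 hk (by omega),
    seriesTerm_example_of_lt hw ht0 (by simpa using h1.ne') (by omega), Nat.sub_add_cancel hk]
  simp [div_eq_mul_inv]

theorem not_isPolynomial_scalarMoment_example (ht0 : 0 < t) (ht1 : t < 1) :
    ¬ IsPolynomialInInverses (scalarMoment (exampleA (2 * M))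
      (exampleY (M : ZMod (2 * M)) t) (EuclideanSpace.single 0 1) (2 * M + 1)) := by
  rintro ⟨p, hp⟩
  refine not_isPolynomial_inv_mix ht0 ht1 (restCoeff M) (antipodeCoeff_ne_zero M) (2 * M + 1)
    (2 * M) ⟨p, fun b h1 h2 => ?_⟩
  have hw := isUnit_weight_ofReal (exampleY_isPositive (M : ZMod (2 * M)) ht0.le)
    (one_sub_exampleY_isPositive _ ht1.le) h1 h2
  have hz' : (t : ℂ) * b.1 + (1 - t) * b.2 ≠ 0 := by
    have : t * b.1 + (1 - t) * b.2 ≠ 0 := by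
      nlinarith [mul_pos ht0 h1, mul_pos (sub_pos.2 ht1) h2]
    exact_mod_cast this
  rw [← hp b h1 h2, scalarMoment_eq_seriesTerm exampleA_isSymmetric
    (exampleY_isPositive _ ht0.le).isSymmetric (fun q hq => exampleY_fixed t hq) hw h1 (by omega)
    le_rfl, Nat.add_sub_cancel, seriesTerm_example_top hw ht0.le (by simpa using h1.ne') hz']

/-- The homogeneous parts of degrees `-k`, `k ≤ 2M + 1`, of the example. -/
def examplePart (M : ℕ) [NeZero (2 * M)] (t : ℝ) (k : ℕ) (z : ℂ × ℂ) : ℂ :=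
  if k = 0 then 0 else if k = 2 * M + 1 then
    -(restCoeff M / z.1 ^ (2 * M + 1) +
      antipodeCoeff M / (z.1 ^ (2 * M) * (t * z.1 + (1 - t) * z.2)))
  else -((walks (2 * M) (k - 1) 0 : ℂ) / z.1 ^ k)

theorem examplePart_smul (k : ℕ) (l : ℂ) (z : ℂ × ℂ) :
    examplePart M t k (l • z) = examplePart M t k z / l ^ k := by
  simp only [examplePart, Prod.smul_fst, Prod.smul_snd, smul_eq_mul]
  split_ifs with h h'
  · simp
  · rw [show (t : ℂ) * (l * z.1) + (1 - t) * (l * z.2) = l * (t * z.1 + (1 - t) * z.2) by ring, h']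
    simp only [div_eq_mul_inv, mul_inv, mul_pow, pow_succ]
    ring
  · simp only [div_eq_mul_inv, mul_inv, mul_pow]
    ring

theorem sum_examplePart (ht0 : 0 ≤ t) (ht1 : t < 1) {z : ℂ × ℂ} (hz : z ∈ biUpper) {K : ℕ}
    (hK : K ≤ 2 * M + 1) :
    ∑ k ∈ Finset.range (K + 1), examplePart M t k z =
      -∑ k ∈ Finset.range K, seriesTerm (exampleA (2 * M)) (exampleY (M : ZMod (2 * M)) t)
        (EuclideanSpace.single 0 1) k z := by
  have hw := isUnit_weight_of_mem_biUpper (M := M) ht0 ht1.le hz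
  have hz1 := fst_ne_zero_of_mem_biUpper hz
  rw [Finset.sum_range_succ', ← Finset.sum_neg_distrib]
  have h0 : examplePart M t 0 z = 0 := if_pos rfl
  rw [h0, add_zero]
  refine Finset.sum_congr rfl fun k hk => ?_
  have hk' := Finset.mem_range.1 hk
  rw [examplePart, if_neg (Nat.succ_ne_zero k)]
  split_ifs with h
  · obtain rfl : k = 2 * M := by omega
    rw [seriesTerm_example_top hw ht0 hz1 (mix_ne_zero_of_mem_biUpper ht0 ht1 hz)]
  · rw [seriesTerm_example_of_lt hw ht0 hz1 (by omega), Nat.add_sub_cancel]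

theorem example_sub_sum_isBigO (ht0 : 0 ≤ t) (ht1 : t < 1) {K : ℕ} (hK : K ≤ 2 * M + 1) (c : ℝ) :
    (fun z => represented (exampleA (2 * M)) (exampleY (M : ZMod (2 * M)) t)
      (EuclideanSpace.single 0 1) z - ∑ k ∈ Finset.range (K + 1), examplePart M t k z)
      =O[nontangential c] (fun z => 1 / ‖z‖ ^ (K + 1)) := by
  refine (represented_add_sum_isBigO (exampleA_isSymmetric (m := 2 * M))
    (exampleY_isPositive (M : ZMod (2 * M)) ht0) (one_sub_exampleY_isPositive _ ht1.le)
    (EuclideanSpace.single 0 1) K c).congr' ?_ (EventuallyEq.refl _ _)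
  refine mem_inf_of_right ?_
  rintro z ⟨hz, -⟩
  show _ = _ - _
  rw [sum_examplePart ht0 ht1 hz hK, sub_neg_eq_add]

theorem example_mem_PickClass (ht0 : 0 ≤ t) (ht1 : t ≤ 1) :
    represented (exampleA (2 * M)) (exampleY (M : ZMod (2 * M)) t)
      (EuclideanSpace.single 0 1) ∈ PickClass :=
  represented_mem_PickClass exampleA_isSymmetric (exampleY_isPositive _ ht0)
    (one_sub_exampleY_isPositive _ ht1) (by simp)

theorem expansionPart_of_support_fst {ρ : ℕ × ℕ → ℝ} (hρ : ∀ n, n.2 ≠ 0 → ρ n = 0) (k : ℕ)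
    (z : ℂ × ℂ) : expansionPart ρ k z = (ρ (k, 0) : ℂ) / z.1 ^ k := by
  rw [expansionPart, Finset.sum_eq_single (k, 0)]
  · simp
  · rintro ⟨a, b⟩ hab hne
    rw [Finset.HasAntidiagonal.mem_antidiagonal] at hab
    rw [hρ _ fun h => hne ?_]
    · simp
    · ext <;> simp_all
  · simp [Finset.HasAntidiagonal.mem_antidiagonal]

theorem example_mem_IntermediateLoewnerClass (ht0 : 0 ≤ t) (ht1 : t < 1) :
    represented (exampleA (2 * M)) (exampleY (M : ZMod (2 * M)) t)
      (EuclideanSpace.single 0 1) ∈ IntermediateLoewnerClass (M + 1) := by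
  refine ⟨example_mem_PickClass (M := M) ht0 ht1.le, tendsto_represented_zero exampleA_isSymmetric
    (exampleY_isPositive _ ht0) (one_sub_exampleY_isPositive _ ht1.le) _,
    -- The coefficient of `1 / z₁^k` is minus the number of closed walks of length `k - 1` at `0`;
    -- no other monomials occur.
    fun n => if n.2 = 0 then (if n.1 = 0 then 0 else -(walks (2 * M) (n.1 - 1) 0 : ℝ)) else 0,
    fun c => ?_⟩
  rw [show 2 * (M + 1) - 2 = 2 * M by omega, show 2 * (M + 1) - 1 = 2 * M + 1 by omega]
  refine (example_sub_sum_isBigO ht0 ht1 (M := M) (Nat.le_succ (2 * M)) c).congr_left fun z => ?_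
  rw [expansion_eq_sum]
  congr 1
  refine Finset.sum_congr rfl fun k hk => ?_
  have hk' := Finset.mem_range.1 hk
  rw [expansionPart_of_support_fst (fun n hn => if_neg hn), examplePart]
  simp only [if_true, if_neg (show k ≠ 2 * M + 1 by omega)]
  split_ifs
  · simp
  · push_cast
    ring

theorem isLittleO_inv_norm_pow_succ (c : ℝ) (K : ℕ) :
    (fun z : ℂ × ℂ => 1 / ‖z‖ ^ (K + 1)) =o[nontangential c] (fun z => 1 / ‖z‖ ^ K) := by
  have h : Tendsto (fun z : ℂ × ℂ => ‖z‖⁻¹) (nontangential c) (𝓝 0) :=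
    tendsto_inv_atTop_zero.comp (tendsto_norm_cobounded_atTop.mono_left inf_le_left)
  have h1 := ((isLittleO_one_iff ℝ).2 h).mul_isBigO
    (isBigO_refl (fun z : ℂ × ℂ => 1 / ‖z‖ ^ K) (nontangential c))
  refine h1.congr (fun z => ?_) fun z => one_mul _
  rw [pow_succ]
  simp [mul_comm]

theorem example_notMem_LoewnerClass (ht0 : 0 < t) (ht1 : t < 1) :
    represented (exampleA (2 * M)) (exampleY (M : ZMod (2 * M)) t)
      (EuclideanSpace.single 0 1) ∉ LoewnerClass (M + 1) := by
  intro h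
  have h1 := isPolynomial_of_mem_LoewnerClass h
    (fun k l z _ => examplePart_smul (M := M) (t := t) k l z)
    -- The expansion is carried to degree `2M + 1`, so the error `O(1 / ‖z‖^(2M+2))` is negligible.
    fun c => (example_sub_sum_isBigO ht0.le ht1 (by omega) c).trans_isLittleO
      (isLittleO_inv_norm_pow_succ c _)
  rw [show 2 * (M + 1) - 1 = 2 * M + 1 by omega] at h1
  refine not_isPolynomial_inv_mix ht0 ht1 (restCoeff M) (antipodeCoeff_ne_zero M) (2 * M + 1)
    (2 * M) ?_
  simpa [examplePart] using h1.neg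

end Series

/-- The function `-1 / ((z₁ + z₂) / 2)`. -/
def negInvMean (z : ℂ × ℂ) : ℂ := -(1 / (((1 / 2 : ℝ) : ℂ) * z.1 + (1 - ((1 / 2 : ℝ) : ℂ)) * z.2))

theorem negInvMean_mem : negInvMean ∈ IntermediateLoewnerClass 1 := by
  refine ⟨⟨fun z hz => ?_, fun z hz => ?_⟩, ?_, 0, fun c => ?_⟩
  · have h := mix_ne_zero_of_mem_biUpper (t := 1 / 2) (by norm_num) (by norm_num) hz
    refine DifferentiableAt.differentiableWithinAt ?_
    unfold negInvMean
    fun_prop (disch := exact h)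
  · have h := mix_ne_zero_of_mem_biUpper (t := 1 / 2) (by norm_num) (by norm_num) hz
    rw [negInvMean, one_div, Complex.neg_im, Complex.inv_im, neg_div, neg_neg]
    refine div_pos ?_ (Complex.normSq_pos.2 h)
    have h1 := hz.1
    have h2 := hz.2
    have h3 : (((1 / 2 : ℝ) : ℂ) * z.1 + (1 - ((1 / 2 : ℝ) : ℂ)) * z.2).im =
        1 / 2 * z.1.im + (1 - 1 / 2) * z.2.im := by
      rw [← Complex.ofReal_one, ← Complex.ofReal_sub, Complex.add_im, Complex.im_ofReal_mul,
        Complex.im_ofReal_mul]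
    rw [h3]
    linarith
  · refine squeeze_zero_norm' ?_ tendsto_inv_atTop_zero
    filter_upwards [eventually_gt_atTop 0] with s hs
    rw [negInvMean, ← add_mul, add_sub_cancel, one_mul]
    simp [abs_of_pos hs]
  · refine IsBigO.of_bound |c| (mem_inf_of_right ?_)
    rintro z ⟨hz, hzc⟩
    have hμ := lt_min hz.1 hz.2
    have hz0 : 0 < ‖z‖ := (hz.1.trans_le (Complex.im_le_norm _)).trans_le (norm_fst_le z)
    have h3 : (((1 / 2 : ℝ) : ℂ) * z.1 + (1 - ((1 / 2 : ℝ) : ℂ)) * z.2).im =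
        1 / 2 * z.1.im + (1 - 1 / 2) * z.2.im := by
      rw [← Complex.ofReal_one, ← Complex.ofReal_sub, Complex.add_im, Complex.im_ofReal_mul,
        Complex.im_ofReal_mul]
    have h4 : min z.1.im z.2.im ≤
        ‖((1 / 2 : ℝ) : ℂ) * z.1 + (1 - ((1 / 2 : ℝ) : ℂ)) * z.2‖ := by
      refine le_trans ?_ (Complex.im_le_norm _)
      rw [h3]
      linarith [min_le_left z.1.im z.2.im, min_le_right z.1.im z.2.im]
    have h5 : expansion 0 (2 * 1 - 2) z = 0 := by simp [expansion]
    show ‖negInvMean z - _‖ ≤ _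
    rw [h5, sub_zero, negInvMean, norm_neg, norm_div, norm_one, Real.norm_of_nonneg (by positivity),
      show 2 * 1 - 1 = 1 from rfl, pow_one, mul_one_div, div_le_div_iff₀ (hμ.trans_le h4) hz0,
      one_mul]
    exact hzc.trans ((mul_le_mul_of_nonneg_right (le_abs_self c) hμ.le).trans
      (mul_le_mul_of_nonneg_left h4 (abs_nonneg c)))

theorem negInvMean_notMem : negInvMean ∉ LoewnerClass 1 := by
  intro h
  have h1 := isPolynomial_of_mem_LoewnerClass h
    -- The function is homogeneous of degree `-1`, hence is its own expansion.
    (g := fun k z => if k = 1 then negInvMean z else 0) ?_ fun c => ?_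
  · have h2 := h1.neg
    refine not_isPolynomial_inv_mix (t := 1 / 2) (by norm_num) (by norm_num) 0 one_ne_zero 0 0 ?_
    simpa [negInvMean] using h2
  · intro k l z hl
    split_ifs with hk
    · rw [negInvMean, negInvMean, hk, pow_one]
      simp only [Prod.smul_fst, Prod.smul_snd, smul_eq_mul]
      rw [neg_div, div_div]
      congr 2
      ring
    · simp
  · simp

/-- The cycle has length `2(N - 1)`, which degenerates for `N = 1`; hence the separate witness. -/
theorem LoewnerClass_ssubset (N : ℕ) (hN : 1 ≤ N) :
    LoewnerClass N ⊂ IntermediateLoewnerClass N := by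
  refine (Set.ssubset_iff_of_subset (LoewnerClass_subset N hN)).2 ?_
  rcases hN.lt_or_eq with h | rfl
  · obtain ⟨M, rfl⟩ : ∃ M, N = M + 1 := ⟨N - 1, by omega⟩
    have : NeZero (2 * M) := ⟨by omega⟩
    exact ⟨_, example_mem_IntermediateLoewnerClass (M := M) (t := 1 / 2) (by norm_num)
      (by norm_num), example_notMem_LoewnerClass (by norm_num) (by norm_num)⟩
  · exact ⟨_, negInvMean_mem, negInvMean_notMem⟩

end Loewner

end

theorem mainTheorem3 :
    (∀ (n : ℕ) (_ : 2 ≤ n) [NeZero (2 * (n - 1))] (t : ℝ) (_ : 0 < t) (_ : t < 1)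
      (A Y : EuclideanSpace ℂ (ZMod (2 * (n - 1))) →L[ℂ] EuclideanSpace ℂ (ZMod (2 * (n - 1))))
      (_ : A = Loewner.exampleA (2 * (n - 1)))
      (_ : Y = Loewner.exampleY ((n - 1 : ℕ) : ZMod (2 * (n - 1))) t)
      (α : EuclideanSpace ℂ (ZMod (2 * (n - 1))))
      (_ : α = EuclideanSpace.single 0 1),
      IsSelfAdjoint A ∧ Y.IsPositive ∧ (1 - Y).IsPositive ∧
      (∀ z ∈ Loewner.biUpper, IsUnit (A - Loewner.weight Y z)) ∧
      (∀ b : ℝ × ℝ, 0 < b.1 → 0 < b.2 →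
        IsUnit (Loewner.weight Y ((b.1 : ℂ), (b.2 : ℂ)))) ∧
      Loewner.represented A Y α ∈ Loewner.PickClass ∧
      (∀ k : ℕ, 1 ≤ k → k < 2 * n - 1 →
        Loewner.IsPolynomialInInverses (Loewner.scalarMoment A Y α k)) ∧
      ¬ Loewner.IsPolynomialInInverses (Loewner.scalarMoment A Y α (2 * n - 1)) ∧
      Loewner.represented A Y α ∈ Loewner.IntermediateLoewnerClass n ∧
      Loewner.represented A Y α ∉ Loewner.LoewnerClass n) ∧
    (∀ N : ℕ, 1 ≤ N → Loewner.LoewnerClass N ⊂ Loewner.IntermediateLoewnerClass N) := by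
  refine ⟨?_, Loewner.LoewnerClass_ssubset⟩
  rintro n hn _ t ht0 ht1 A Y rfl rfl α rfl
  obtain ⟨M, rfl⟩ : ∃ M, n = M + 1 := ⟨n - 1, by omega⟩
  have hY := Loewner.exampleY_isPositive ((M + 1 - 1 : ℕ) : ZMod (2 * (M + 1 - 1))) ht0.le
  have hY' := Loewner.one_sub_exampleY_isPositive
    ((M + 1 - 1 : ℕ) : ZMod (2 * (M + 1 - 1))) ht1.le
  refine ⟨ContinuousLinearMap.isSelfAdjoint_iff_isSymmetric.2 Loewner.exampleA_isSymmetric,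
    hY, hY', fun z hz => (Loewner.isUnit_of_coercive _ (lt_min hz.1 hz.2)
      (Loewner.sub_weight_coercive Loewner.exampleA_isSymmetric hY hY' z)).1,
    fun b h1 h2 => Loewner.isUnit_weight_ofReal hY hY' h1 h2,
    Loewner.example_mem_PickClass ht0.le ht1.le,
    fun k hk hkM => Loewner.isPolynomial_scalarMoment_example ht0.le ht1.le hk (by omega), ?_,
    Loewner.example_mem_IntermediateLoewnerClass (M := M + 1 - 1) ht0.le ht1,
    Loewner.example_notMem_LoewnerClass (M := M + 1 - 1) ht0 ht1⟩
  exact Loewner.not_isPolynomial_scalarMoment_example (M := M + 1 - 1) ht0 ht1
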